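/- For a complex number $\lambda$, let the arboreal height of $\lambda$ be the least $h$ such that some finite rooted tree of height $h$ (the height being the largest distance from the root to a vertex) has $\lambda$ as an eigenvalue of its adjacency matrix (and $\infty$ if $\lambda$ is not an eigenvalue of any finite tree). Let $m\ge 1$ be an integer and let $\zeta_m\in\mathbb{C}$ be a primitive $m$-th root of unity. If $\zeta_m+\zeta_m^{-1}$ has arboreal height at most $2$, then $m\in\{1,2,3,4,5,6,8,10,12,16,20,24\}$. -/

import Mathlib

/-- `lam` is an eigenvalue of (the adjacency matrix of) some finite rooted tree of height `h`.
The tree is a graph `G` on `n` vertices with root `r`, and its height is the largest distance from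
the root to a vertex, that is, the eccentricity of `r`. -/
def IsRootedTreeEigenvalue (lam : ℂ) (h : ℕ) : Prop :=
  open Classical in
  ∃ (n : ℕ) (G : SimpleGraph (Fin n)) (r : Fin n),
    G.IsTree ∧ G.eccent r = (h : ℕ∞) ∧
      Module.End.HasEigenvalue (Matrix.toLin' (G.adjMatrix ℂ)) lam

/-- The arboreal height of `lam`: the least `h` such that `lam` is an eigenvalue of a rooted tree of
height `h`. It is `⊤` if `lam` is not an eigenvalue of any finite tree; in particular it is `⊤` if
`lam` is not a totally real algebraic integer. -/
noncomputable def arborealHeight (lam : ℂ) : ℕ∞ :=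
  ⨅ (h : ℕ) (_ : IsRootedTreeEigenvalue lam h), (h : ℕ∞)

/-! In a tree of height at most 2, eliminating the non-root entries of an eigenvector leaves `∑ 1 /
(lam ^ 2 - a c) = 1` over the children `c` of the root, `a c` counting the leaves below `c`, unless
`lam ^ 2` is a natural number (`secular_equation`). For `lam = ζ + ζ⁻¹` and `η = ζ ^ 2`, `lam ^ 2 -
2 = η + η⁻¹`, so `Φ_n`, with `n` the order of `η`, divides a `secularNumerator` over `ℤ`. Modulo `p`
only `p` distinct denominators remain; if all are invertible modulo `Φ_n`, then `φ(n) ≤ 2p`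
(`totient_le_of_isUnit`). The primes 2 and 3 together give `φ(n) ≤ 4`, hence finitely many `n`. -/

open Polynomial in
/-- The homogenised form `X ^ 2 + 1 - a X` of the linear polynomial `x - a` at `x = X + X⁻¹`. -/
noncomputable def palindromicQuadratic {R : Type*} [CommRing R] (a : R) : R[X] :=
  X ^ 2 - C a * X + 1

open Polynomial in
theorem palindromicQuadratic_map {R S : Type*} [CommRing R] [CommRing S] (f : R →+* S) (a : R) :
    (palindromicQuadratic a).map f = palindromicQuadratic (f a) := by
  simp [palindromicQuadratic]

open Polynomial in
theorem palindromicQuadratic_natDegree {R : Type*} [CommRing R] [Nontrivial R] (a : R) :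
    (palindromicQuadratic a).natDegree = 2 := by
  unfold palindromicQuadratic
  compute_degree!

open Polynomial in
theorem palindromicQuadratic_monic {R : Type*} [CommRing R] (a : R) :
    (palindromicQuadratic a).Monic := by
  unfold palindromicQuadratic
  monicity!

/-! ### Clearing denominators and reducing modulo a prime. -/

theorem prod_mul_sum_inverse {ι R : Type*} [DecidableEq ι] [CommRing R] (s : Finset ι)
    (u w : ι → R) (h : ∀ i ∈ s, u i * w i = 1) :
    (∏ i ∈ s, u i) * ∑ i ∈ s, w i = ∑ i ∈ s, ∏ k ∈ s.erase i, u k := by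
  rw [Finset.mul_sum]
  refine Finset.sum_congr rfl fun i hi => ?_
  rw [← Finset.mul_prod_erase s u hi]
  linear_combination (∏ k ∈ s.erase i, u k) * h i hi

open Polynomial in
/-- The numerator of `1 - ∑ i ∈ s, 1 / (x - a i)` at `x = X + X⁻¹`. -/
noncomputable def secularNumerator {ι R : Type*} [DecidableEq ι] [CommRing R] (s : Finset ι)
    (a : ι → R) : R[X] :=
  ∏ i ∈ s, palindromicQuadratic (a i)
    - X * ∑ i ∈ s, ∏ k ∈ s.erase i, palindromicQuadratic (a k)

-- Grouping the terms by the residue of `a i` and clearing the `p` resulting denominators gives a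
-- monic multiple of `Φ_n` of degree `2p`, however large `s` is.
open Polynomial in
theorem totient_le_of_isUnit {ι : Type*} [DecidableEq ι] (p n : ℕ) [Fact p.Prime]
    (s : Finset ι) (a : ι → ℤ)
    (hdvd : cyclotomic n ℤ ∣ secularNumerator s a)
    (hunit : ∀ j : ZMod p, IsUnit
      (AdjoinRoot.mk (cyclotomic n (ZMod p)) (palindromicQuadratic j))) :
    n.totient ≤ 2 * p := by
  classical
  set Φ := cyclotomic n (ZMod p) with hΦ
  set π := AdjoinRoot.mk Φ with hπ
  choose w hw using fun j => (hunit j).exists_right_inv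
  have h1 : π (secularNumerator s fun i => (a i : ZMod p)) = 0 := by
    rw [hπ, AdjoinRoot.mk_eq_zero]
    have := Polynomial.map_dvd (Int.castRingHom (ZMod p)) hdvd
    simpa [secularNumerator, Polynomial.map_prod, Polynomial.map_sum, palindromicQuadratic_map]
      using this
  have h2 : π X * ∑ i ∈ s, w (a i) = 1 := by
    have h3 := prod_mul_sum_inverse s (fun i => π (palindromicQuadratic (a i : ZMod p)))
      (fun i => w (a i)) fun i _ => hw _
    have h4 : IsUnit (∏ i ∈ s, π (palindromicQuadratic (a i : ZMod p))) :=
      IsUnit.prod_iff.2 fun i _ => hunit _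
    simp only [secularNumerator, map_sub, map_mul, map_prod, map_sum] at h1
    apply h4.mul_left_cancel
    linear_combination π X * h3 - h1
  set N : ZMod p → ZMod p := fun j => ((s.filter fun i => (a i : ZMod p) = j).card : ZMod p)
  have h5 : ∑ i ∈ s, w (a i) = ∑ j, π (C (N j)) * w j := by
    rw [← Finset.sum_fiberwise s (fun i => (a i : ZMod p))]
    refine Finset.sum_congr rfl fun j _ => ?_
    rw [Finset.sum_congr rfl (g := fun _ => w j)
      (fun i hi => by rw [(Finset.mem_filter.1 hi).2])]
    simp [N]
  set D : (ZMod p)[X] :=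
    X * ∑ j, C (N j) * ∏ k ∈ Finset.univ.erase j, palindromicQuadratic k with hD
  set M : (ZMod p)[X] := ∏ j : ZMod p, palindromicQuadratic j with hM
  have hMm : M.Monic := monic_prod_of_monic _ _ fun j _ => palindromicQuadratic_monic j
  have hMd : M.natDegree = 2 * p := by
    rw [hM, natDegree_prod_of_monic _ _ fun j _ => palindromicQuadratic_monic j]
    simp [palindromicQuadratic_natDegree, ZMod.card, mul_comm]
  have hp := (Fact.out : p.Prime).two_le
  have hDd : D.natDegree < 2 * p := by
    have : (∑ j, C (N j) * ∏ k ∈ Finset.univ.erase j, palindromicQuadratic k).natDegree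
        ≤ 2 * (p - 1) := by
      refine natDegree_sum_le_of_forall_le _ _ fun j _ => ?_
      refine (natDegree_C_mul_le _ _).trans ?_
      rw [natDegree_prod_of_monic _ _ fun j _ => palindromicQuadratic_monic j]
      simp [palindromicQuadratic_natDegree, ZMod.card, mul_comm]
    have h6 := natDegree_mul_le (p := (X : (ZMod p)[X])) (q := ∑ j, C (N j) *
      ∏ k ∈ Finset.univ.erase j, palindromicQuadratic k)
    rw [natDegree_X, ← hD] at h6
    omega
  have hdeg : D.degree < M.degree := by
    apply degree_lt_degree
    omega
  have hmon : (M - D).Monic := hMm.sub_of_left hdeg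
  have hzero : Φ ∣ M - D := by
    rw [← AdjoinRoot.mk_eq_zero, ← hπ, map_sub, sub_eq_zero]
    have h7 : π M = π M * (π X * ∑ i ∈ s, w (a i)) := by rw [h2, mul_one]
    rw [h7, h5, hD, map_mul, map_sum, mul_left_comm, Finset.mul_sum]
    congr 1
    refine Finset.sum_congr rfl fun j _ => ?_
    rw [map_mul, hM, map_prod, map_prod, ← Finset.mul_prod_erase _ _ (Finset.mem_univ j)]
    linear_combination π (C (N j)) * (∏ k ∈ Finset.univ.erase j, π (palindromicQuadratic k)) * hw j
  have := natDegree_le_of_dvd hzero hmon.ne_zero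
  rw [hΦ, natDegree_cyclotomic] at this
  refine this.trans ((natDegree_sub_le _ _).trans ?_)
  omega

open Polynomial in
/-- A quadratic `X ^ 2 - j X + 1` is a unit modulo `Φ_n` in characteristic `p`, unless it vanishes
at a primitive root of unity of order the prime-to-`p` part of `n`. -/
theorem isUnit_mk_palindromicQuadratic (p k n : ℕ) [Fact p.Prime] (hn : ¬ p ∣ n) (j : ZMod p)
    (h : ∀ (K : Type) [Field K] [CharP K p] (f : ZMod p →+* K) (x : K), IsPrimitiveRoot x n →
      x ^ 2 - f j * x + 1 ≠ 0) :
    IsUnit (AdjoinRoot.mk (cyclotomic (p ^ k * n) (ZMod p)) (palindromicQuadratic j)) := by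
  -- A nonunit lies in a maximal ideal; in the residue field `X` becomes a root of `Φ_(p^k n)`,
  -- which in characteristic `p` is a primitive `n`-th root of unity.
  by_contra hu
  obtain ⟨I, hI, hmem⟩ := exists_max_ideal_of_mem_nonunits hu
  let : Field (AdjoinRoot (cyclotomic (p ^ k * n) (ZMod p)) ⧸ I) := Ideal.Quotient.field I
  set g := (Ideal.Quotient.mk I).comp (AdjoinRoot.mk (cyclotomic (p ^ k * n) (ZMod p)))
  have : CharP (AdjoinRoot (cyclotomic (p ^ k * n) (ZMod p)) ⧸ I) p :=
    charP_of_injective_ringHom (g.comp C).injective p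
  have hnz : NeZero (n : AdjoinRoot (cyclotomic (p ^ k * n) (ZMod p)) ⧸ I) :=
    ⟨fun h0 => hn ((CharP.cast_eq_zero_iff _ p n).1 h0)⟩
  have hge : ∀ q : (ZMod p)[X], g q = q.eval₂ (g.comp C) (g X) := by
    intro q
    rw [← hom_eval₂, eval₂_C_X]
  have hroot : IsRoot (cyclotomic (p ^ k * n) (AdjoinRoot (cyclotomic (p ^ k * n) (ZMod p)) ⧸ I))
      (g X) := by
    rw [← map_cyclotomic _ (g.comp C), IsRoot, eval_map, ← hge]
    simp [g]
  rw [isRoot_cyclotomic_prime_pow_mul_iff_of_charP] at hroot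
  refine h _ (g.comp C) (g X) hroot ?_
  have h0 : g (palindromicQuadratic j) = 0 := Ideal.Quotient.eq_zero_iff_mem.2 hmem
  simpa [palindromicQuadratic] using h0

theorem totient_bound_of_sum {ι : Type*} [DecidableEq ι] (n : ℕ) (hn : 0 < n)
    (s : Finset ι) (a : ι → ℤ)
    (hdvd : Polynomial.cyclotomic n ℤ ∣ secularNumerator s a) : n.totient ≤ 4 := by
  -- The prime 2 fails only when the odd part of `n` is 1 or 3; the prime 3 handles those `n`.
  by_cases hdiv : ∃ k, n = 2 ^ k ∨ n = 2 ^ k * 3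
  · by_contra hlt
    obtain ⟨k, i, hk, hnk⟩ : ∃ k i, 3 ≤ k ∧ n = 3 ^ i * 2 ^ k := by
      obtain ⟨k, rfl | rfl⟩ := hdiv
      · refine ⟨k, 0, ?_, by simp⟩
        by_contra hk
        interval_cases k <;> revert hlt <;> decide
      · refine ⟨k, 1, ?_, by ring⟩
        by_contra hk
        interval_cases k <;> revert hlt <;> decide
    have h6 : n.totient ≤ 2 * 3 := by
      refine totient_le_of_isUnit 3 n s a hdvd fun j => ?_
      rw [hnk]
      refine isUnit_mk_palindromicQuadratic 3 i (2 ^ k) ?_ j ?_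
      · intro h
        have := Nat.prime_three.dvd_of_dvd_pow h
        omega
      · intro K _ _ f x hx h0
        have h3 : (3 : K) = 0 := by exact_mod_cast CharP.cast_eq_zero K 3
        -- Modulo 3 the quadratics are `X ^ 2 + 1`, `(X + 1) ^ 2` and `(X - 1) ^ 2`, so their roots
        -- have order dividing 4, whereas `2 ^ k ≥ 8`.
        have h4 : x ^ 4 = 1 := by
          have hj : j = 0 ∨ j = 1 ∨ j = -1 := by clear h0; decide +revert
          rcases hj with rfl | rfl | rfl
          · simp only [map_zero] at h0
            linear_combination (x ^ 2 - 1) * h0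
          · simp only [map_one] at h0
            have h1 : x + 1 = 0 := by
              apply pow_eq_zero_iff (two_ne_zero) |>.1
              linear_combination h0 + x * h3
            linear_combination (x - 1) * (x ^ 2 + 1) * h1
          · simp only [map_neg, map_one] at h0
            have h1 : x - 1 = 0 := by
              apply pow_eq_zero_iff (two_ne_zero) |>.1
              linear_combination h0 - x * h3
            linear_combination (x + 1) * (x ^ 2 + 1) * h1
        have h5 := Nat.le_of_dvd (by norm_num) (hx.dvd_of_pow_eq_one 4 h4)
        have h7 := Nat.pow_le_pow_right (show 0 < 2 by norm_num) hk
        omega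
    have h8 : (2 ^ 3).totient ∣ (2 ^ k).totient := Nat.totient_dvd_of_dvd (pow_dvd_pow 2 hk)
    have h8' : (2 ^ k).totient ∣ n.totient := Nat.totient_dvd_of_dvd (hnk ▸ dvd_mul_left _ _)
    -- No multiple of 4 satisfies `4 < φ(n) ≤ 6`.
    have h4 : 4 ∣ n.totient := (show (2 ^ 3).totient = 4 by decide) ▸ h8.trans h8'
    omega
  · obtain ⟨k, l, hl, hnl⟩ := Nat.exists_eq_pow_mul_and_not_dvd hn.ne' 2 (by norm_num)
    refine totient_le_of_isUnit 2 n s a hdvd fun j => ?_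
    rw [hnl]
    refine isUnit_mk_palindromicQuadratic 2 k l hl j ?_
    intro K _ _ f x hx h0
    have h2 : (2 : K) = 0 := by exact_mod_cast CharP.cast_eq_zero K 2
    -- Modulo 2 the quadratics are `(X + 1) ^ 2` and `X ^ 2 + X + 1`.
    have h3 : x ^ 3 = 1 := by
      have hj : j = 0 ∨ j = 1 := by clear h0; decide +revert
      rcases hj with rfl | rfl
      · simp only [map_zero] at h0
        have h1 : x + 1 = 0 := by
          apply pow_eq_zero_iff (two_ne_zero) |>.1
          linear_combination h0 + x * h2
        linear_combination (x ^ 2 - x + 1) * h1 - h2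
      · simp only [map_one] at h0
        linear_combination (x + 1) * h0 - h2
    have h4 := (Nat.dvd_prime Nat.prime_three).1 (hx.dvd_of_pow_eq_one 3 h3)
    refine hdiv ⟨k, ?_⟩
    rcases h4 with rfl | rfl
    · simpa using Or.inl hnl
    · exact Or.inr hnl

/-! ### Complex roots of unity and small totients. -/

open Polynomial in
theorem cyclotomic_dvd_of_aeval_eq_zero {n : ℕ} (hn : 0 < n) {η : ℂ} (hη : IsPrimitiveRoot η n)
    {q : ℤ[X]} (hq : aeval η q = 0) : cyclotomic n ℤ ∣ q := by
  rw [cyclotomic_eq_minpoly hη hn]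
  exact minpoly.isIntegrallyClosed_dvd (hη.isIntegral hn) hq

open Polynomial in
theorem totient_le_of_int_trace {n : ℕ} (hn : 0 < n) {η : ℂ} (hη : IsPrimitiveRoot η n)
    (b : ℤ) (hb : η + η⁻¹ = b) : n.totient ≤ 2 := by
  have hη0 : η ≠ 0 := hη.ne_zero hn.ne'
  have h := cyclotomic_dvd_of_aeval_eq_zero hn hη (q := palindromicQuadratic b) (by
    simp only [palindromicQuadratic, map_add, map_sub, map_mul, map_pow, aeval_X, map_one,
      aeval_C, algebraMap_int_eq]
    rw [eq_intCast, ← hb]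
    field_simp
    ring)
  have := natDegree_le_of_dvd h (palindromicQuadratic_monic b).ne_zero
  rwa [natDegree_cyclotomic, palindromicQuadratic_natDegree] at this

open Polynomial in
theorem totient_le_of_sum_inv {ι : Type*} {n : ℕ} (hn : 0 < n) {η : ℂ}
    (hη : IsPrimitiveRoot η n) (s : Finset ι) (a : ι → ℤ)
    (ha : ∀ i ∈ s, η + η⁻¹ ≠ a i) (hs : ∑ i ∈ s, (η + η⁻¹ - a i)⁻¹ = 1) : n.totient ≤ 4 := by
  classical
  have hη0 : η ≠ 0 := hη.ne_zero hn.ne'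
  have hq : ∀ i, aeval η (palindromicQuadratic (a i)) = η * (η + η⁻¹ - a i) := by
    intro i
    simp only [palindromicQuadratic, map_add, map_sub, map_mul, map_pow, aeval_X, map_one,
      aeval_C]
    simp only [algebraMap_int_eq, eq_intCast]
    field_simp
    ring
  refine totient_bound_of_sum n hn s a (cyclotomic_dvd_of_aeval_eq_zero hn hη ?_)
  have h1 := prod_mul_sum_inverse s (fun i => aeval η (palindromicQuadratic (a i)))
    (fun i => η⁻¹ * (η + η⁻¹ - a i)⁻¹) fun i hi => by
      have := sub_ne_zero.2 (ha i hi)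
      simp only [hq]
      rw [mul_mul_mul_comm, mul_inv_cancel₀ hη0, mul_inv_cancel₀ this, one_mul]
  rw [← Finset.mul_sum, hs, mul_one] at h1
  simp only [secularNumerator, map_sub, map_mul, map_prod, map_sum, aeval_X]
  rw [← h1]
  field_simp
  ring

theorem mem_of_totient_le_four {n : ℕ} (hn : 0 < n) (h : n.totient ≤ 4) :
    n ∈ ({1, 2, 3, 4, 5, 6, 8, 10, 12} : Finset ℕ) := by
  have hle : ∀ d, d ∣ n → d.totient ≤ 4 := fun d hd =>
    (Nat.le_of_dvd (Nat.totient_pos.2 hn) (Nat.totient_dvd_of_dvd hd)).trans h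
  -- `φ(16)`, `φ(9)`, `φ(25)` and `φ(p)` for `p > 5` all exceed 4, so `n` divides `8 * 3 * 5`.
  have hdvd : n ∣ 120 := by
    rw [Nat.dvd_iff_prime_pow_dvd_dvd]
    intro p k hp hk
    rcases Nat.eq_zero_or_pos k with rfl | hk0
    · simp
    have hp5 : p ≤ 5 := by
      have := hle p ((dvd_pow_self p hk0.ne').trans hk)
      rw [Nat.totient_prime hp] at this
      omega
    have hsmall : ∀ e, 4 < (p ^ e).totient → k < e := by
      intro e he
      by_contra hke
      have := hle (p ^ e) ((pow_dvd_pow p (not_lt.1 hke)).trans hk)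
      omega
    interval_cases p
    · exact absurd hp (by decide)
    · exact absurd hp (by decide)
    · have := hsmall 4 (by decide)
      interval_cases k <;> decide
    · have := hsmall 2 (by decide)
      interval_cases k; decide
    · exact absurd hp (by decide)
    · have := hsmall 2 (by decide)
      interval_cases k; decide
  have hmem : n ∈ Nat.divisors 120 := Nat.mem_divisors.2 ⟨hdvd, by norm_num⟩
  have hall : ∀ d ∈ Nat.divisors 120, d.totient ≤ 4 →
      d ∈ ({1, 2, 3, 4, 5, 6, 8, 10, 12} : Finset ℕ) := by decide +kernel
  exact hall n hmem h

/-! ### Rooted trees of height at most two -/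

namespace SimpleGraph

variable {V : Type*} {G : SimpleGraph V}

theorem exists_of_eccent_le_two (hG : G.Connected) {r : V} (hr : G.eccent r ≤ 2) (w : V) :
    w = r ∨ G.Adj r w ∨ ∃ c, G.Adj r c ∧ G.Adj c w := by
  obtain ⟨p, hp⟩ := hG.exists_walk_length_eq_edist r w
  have hlen : p.length ≤ 2 := by
    have : (p.length : ℕ∞) ≤ 2 := hp ▸ edist_le_eccent.trans hr
    exact_mod_cast this
  match p, hlen with
  | .nil, _ => exact Or.inl rfl
  | .cons h .nil, _ => exact Or.inr (Or.inl h)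
  | .cons h (.cons h' .nil), _ => exact Or.inr (Or.inr ⟨_, h, h'⟩)
  | .cons _ (.cons _ (.cons _ q)), hl => simp at hl

theorem IsAcyclic.eq_of_isPath (hG : G.IsAcyclic) {u v : V} {p q : G.Walk u v}
    (hp : p.IsPath) (hq : q.IsPath) : p = q :=
  congrArg Subtype.val ((hG.subsingleton_path u v).elim ⟨p, hp⟩ ⟨q, hq⟩)

theorem IsAcyclic.not_adj_of_common_neighbor (hG : G.IsAcyclic) {r c d : V} (hc : G.Adj r c)
    (hd : G.Adj r d) : ¬ G.Adj c d := by
  intro h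
  have := hG.eq_of_isPath (p := Walk.cons hd .nil) (q := Walk.cons hc (Walk.cons h .nil))
    (by simp [hd.ne]) (by simp [hc.ne, hd.ne, h.ne])
  simpa using congrArg Walk.length this

theorem IsAcyclic.eq_of_two_paths (hG : G.IsAcyclic) {r c d w : V} (hwr : w ≠ r)
    (hc : G.Adj r c) (hd : G.Adj r d) (hcw : G.Adj c w) (hdw : G.Adj d w) : c = d := by
  have := hG.eq_of_isPath (p := Walk.cons hc (Walk.cons hcw .nil))
    (q := Walk.cons hd (Walk.cons hdw .nil))
    (by simp [hc.ne, hcw.ne, hwr.symm]) (by simp [hd.ne, hdw.ne, hwr.symm])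
  simpa using congrArg Walk.support this

/-- An edge `x w` would give paths of lengths 2 and 3 from `r` to `w`. -/
theorem IsAcyclic.not_adj_of_grandchildren (hG : G.IsAcyclic) {r c d w x : V} (hwr : w ≠ r)
    (hxr : x ≠ r) (hw : ¬ G.Adj r w) (hc : G.Adj r c) (hcw : G.Adj c w) (hd : G.Adj r d)
    (hdx : G.Adj d x) : ¬ G.Adj x w := by
  intro h
  have hdw : d ≠ w := by rintro rfl; exact hw hd
  have := hG.eq_of_isPath (p := Walk.cons hc (Walk.cons hcw .nil))
    (q := Walk.cons hd (Walk.cons hdx (Walk.cons h .nil)))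
    (by simp [hc.ne, hcw.ne, hwr.symm])
    (by simp [hd.ne, hdx.ne, h.ne, hwr.symm, hxr.symm, hdw])
  simpa using congrArg Walk.length this

/-- The secular equation of a rooted tree of height at most two. -/
theorem secular_equation {n : ℕ} {G : SimpleGraph (Fin n)} [DecidableRel G.Adj] (hG : G.IsTree)
    {r : Fin n} (hr : G.eccent r ≤ 2) {lam : ℂ}
    (hlam : Module.End.HasEigenvalue (Matrix.toLin' (G.adjMatrix ℂ)) lam) :
    (∃ a : ℕ, lam ^ 2 = a) ∨ ∃ (s : Finset (Fin n)) (a : Fin n → ℕ),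
      (∀ i ∈ s, lam ^ 2 ≠ a i) ∧ ∑ i ∈ s, (lam ^ 2 - a i)⁻¹ = 1 := by
  classical
  obtain ⟨v, hv⟩ := hlam.exists_hasEigenvector
  have heq : ∀ x, ∑ y ∈ G.neighborFinset x, v y = lam * v x := by
    intro x
    have := congrFun hv.apply_eq_smul x
    simpa [Matrix.toLin'_apply, adjMatrix_mulVec_apply] using this
  by_cases h0 : lam = 0
  · exact Or.inl ⟨0, by simp [h0]⟩
  refine or_iff_not_imp_left.2 fun hne => ?_
  push Not at hne
  have hac := hG.isAcyclic
  have hcases := exists_of_eccent_le_two hG.connected hr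
  -- A grandchild of the root has no neighbour but its parent.
  have hleaf : ∀ c w, G.Adj r c → G.Adj c w → w ≠ r → lam * v w = v c := by
    intro c w hc hcw hwr
    have hw : ¬ G.Adj r w := fun h => hac.not_adj_of_common_neighbor hc h hcw
    have hnb : G.neighborFinset w = {c} := by
      ext x
      simp only [mem_neighborFinset, Finset.mem_singleton]
      refine ⟨fun hx => ?_, fun hx => hx ▸ hcw.symm⟩
      have hxr : x ≠ r := by rintro rfl; exact hw hx.symm
      rcases hcases x with rfl | hx' | ⟨d, hd, hdx⟩
      · exact absurd rfl hxr
      · exact hac.eq_of_two_paths hwr hx' hc hx.symm hcw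
      · exact absurd hx.symm (hac.not_adj_of_grandchildren hwr hxr hw hc hcw hd hdx)
    rw [← heq w, hnb, Finset.sum_singleton]
  set a : Fin n → ℕ := fun c => ((G.neighborFinset c).erase r).card with ha
  have hchild : ∀ c, G.Adj r c → v c = lam * v r * (lam ^ 2 - a c)⁻¹ := by
    intro c hc
    have h1 : lam * v c = v r + ∑ w ∈ (G.neighborFinset c).erase r, v w := by
      rw [← heq c, Finset.add_sum_erase _ _ (by simpa using hc.symm)]
    have h2 : lam * ∑ w ∈ (G.neighborFinset c).erase r, v w = a c * v c := by
      rw [Finset.mul_sum, Finset.sum_congr rfl (g := fun _ => v c), Finset.sum_const, nsmul_eq_mul]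
      intro w hw
      rw [Finset.mem_erase, mem_neighborFinset] at hw
      exact hleaf c w hc hw.2 hw.1
    rw [eq_mul_inv_iff_mul_eq₀ (sub_ne_zero.2 (hne _))]
    linear_combination lam * h1 + h2
  -- If `v r` vanished, so would the entries at the children, then those at the grandchildren.
  have hroot : v r ≠ 0 := by
    intro hr0
    refine hv.2 (funext fun w => ?_)
    have hc0 : ∀ c, G.Adj r c → v c = 0 := fun c hc => by simp [hchild c hc, hr0]
    rcases hcases w with rfl | hw | ⟨c, hc, hcw⟩
    · exact hr0
    · exact hc0 w hw
    · by_cases hwr : w = r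
      · rw [hwr]; exact hr0
      · have := hleaf c w hc hcw hwr
        rw [hc0 c hc] at this
        exact (mul_eq_zero.1 this).resolve_left h0
  refine ⟨G.neighborFinset r, a, fun i _ => hne _, ?_⟩
  have h3 := heq r
  rw [Finset.sum_congr rfl fun c hc => hchild c (by simpa using hc), ← Finset.mul_sum] at h3
  exact mul_left_cancel₀ (mul_ne_zero h0 hroot) (by rw [h3, mul_one])

end SimpleGraph

/-! ### From height to the order of the root of unity. -/

theorem exists_of_arborealHeight_le {lam : ℂ} {k : ℕ} (h : arborealHeight lam ≤ k) :
    ∃ j ≤ k, IsRootedTreeEigenvalue lam j := by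
  have hlt : arborealHeight lam < (k + 1 : ℕ) :=
    h.trans_lt (by exact_mod_cast Nat.lt_succ_self k)
  simp only [arborealHeight, iInf_lt_iff] at hlt
  obtain ⟨j, hj, hjk⟩ := hlt
  exact ⟨j, Nat.lt_succ_iff.1 (by exact_mod_cast hjk), hj⟩

theorem mainTheorem5 (m : ℕ) (hm : 0 < m) (ζ : ℂ) (hζ : IsPrimitiveRoot ζ m)
    (hheight : arborealHeight (ζ + ζ⁻¹) ≤ 2) :
    m ∈ ({1, 2, 3, 4, 5, 6, 8, 10, 12, 16, 20, 24} : Finset ℕ) := by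
  classical
  obtain ⟨h, hh, n, G, r, hG, hr, hlam⟩ := exists_of_arborealHeight_le (k := 2) hheight
  have hr2 : G.eccent r ≤ 2 := by rw [hr]; exact_mod_cast hh
  have hζ0 : ζ ≠ 0 := hζ.ne_zero hm.ne'
  have hsq : (ζ + ζ⁻¹) ^ 2 = ζ ^ 2 + (ζ ^ 2)⁻¹ + 2 := by
    field_simp
    ring
  have key : ∀ d, 0 < d → IsPrimitiveRoot (ζ ^ 2) d →
      d ∈ ({1, 2, 3, 4, 5, 6, 8, 10, 12} : Finset ℕ) := by
    intro d hd hη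
    refine mem_of_totient_le_four hd ?_
    rcases SimpleGraph.secular_equation hG hr2 hlam with ⟨a, ha⟩ | ⟨s, a, ha, hs⟩
    · refine (totient_le_of_int_trace hd hη (a - 2) ?_).trans (by norm_num)
      push_cast
      linear_combination ha - hsq
    · have hsub : ∀ i, (ζ + ζ⁻¹) ^ 2 - a i = ζ ^ 2 + (ζ ^ 2)⁻¹ - ((a i - 2 : ℤ) : ℂ) := by
        intro i
        push_cast
        linear_combination hsq
      refine totient_le_of_sum_inv hd hη s (fun i => a i - 2) (fun i hi h0 => ha i hi ?_) ?_
      · exact sub_eq_zero.1 ((hsub i).trans (sub_eq_zero.2 h0))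
      · simpa only [hsub] using hs
  -- `ζ ^ 2` has order `m / 2` for even `m` and `m` for odd `m`, so `m` is twice a listed order or
  -- an odd one.
  rcases Nat.even_or_odd' m with ⟨d, rfl | rfl⟩
  · have := key d (by omega) (hζ.pow hm rfl)
    simp only [Finset.mem_insert, Finset.mem_singleton] at this ⊢
    omega
  · have := key (2 * d + 1) hm (hζ.pow_of_coprime 2 (by simp))
    simp only [Finset.mem_insert, Finset.mem_singleton] at this ⊢
    omega
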